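/- A rooted labeled tree of order $n$ is a tree with vertex set $[n]=\{1,\dots,n\}$ together with a distinguished vertex, its root (so there is none of order $0$). A node $v$ of such a tree is a record if its label is the largest one on the unique path from $v$ to the root (both ends included). For integers $n\ge 0$ and $k\ge 1$ let $R(n,k)$ and $R_{\ge}(n,k)$ be the numbers of rooted labeled trees of order $n$ with precisely $k$ records and with at least $k$ records, respectively, and let \[ \mathcal{R}_k(z)=\sum_{n\ge 0}R(n,k)\,\frac{z^n}{n!},\qquad \mathcal{R}_{\ge k}(z)=\sum_{n\ge 0}R_{\ge}(n,k)\,\frac{z^n}{n!} \] be the corresponding exponential generating functions, regarded as formal power series over $\mathbb{Q}$. Let \[ \mathcal{T}(z)=\sum_{n\ge 1}n^{n-1}\,\frac{z^n}{n!} \] be Cayley's tree function. Then, for every integer $k\ge 1$, \[ \mathcal{R}_{\ge k}(z)=\frac{\mathcal{T}(z)^k}{k} \qquad\text{and}\qquad \mathcal{R}_k(z)=\frac{\mathcal{T}(z)^k}{k}-\frac{\mathcal{T}(z)^{k+1}}{k+1}. \] -/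

import Mathlib

open scoped Nat

/-- A rooted labeled tree of order `n`: a tree whose vertex set is the linearly ordered label set
`Fin n` (standing for `{1, …, n}`; only the order of the labels matters), with a distinguished
vertex, the root. There is none for `n = 0`. -/
@[ext]
structure RootedLabeledTree (n : ℕ) where
  graph : SimpleGraph (Fin n)
  isTree : graph.IsTree
  root : Fin n

namespace RootedLabeledTree

variable {n : ℕ}

/-- There are only finitely many rooted labeled trees of a given order. -/
instance instFinite (n : ℕ) : Finite (RootedLabeledTree n) :=
  Finite.of_injective (fun t : RootedLabeledTree n => (t.graph, t.root)) fun _ _ h =>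
    RootedLabeledTree.ext (congrArg Prod.fst h) (congrArg Prod.snd h)

/-- The node `v` is a record of `t`: it has the largest label along the (unique) path from `v` to
the root. -/
def IsRecord (t : RootedLabeledTree n) (v : Fin n) : Prop :=
  ∀ p : t.graph.Walk v t.root, p.IsPath → ∀ u ∈ p.support, u ≤ v

/-- The number of records of a rooted labeled tree. -/
noncomputable def numRecords (t : RootedLabeledTree n) : ℕ :=
  Nat.card {v : Fin n // t.IsRecord v}

end RootedLabeledTree

/-- The tree record number: the number of rooted labeled trees of order `n` with precisely `k`
records. -/
noncomputable def treeRecordNumber (n k : ℕ) : ℕ :=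
  Nat.card {t : RootedLabeledTree n // t.numRecords = k}

/-- The number of rooted labeled trees of order `n` with at least `k` records. -/
noncomputable def treeRecordGeNumber (n k : ℕ) : ℕ :=
  Nat.card {t : RootedLabeledTree n // k ≤ t.numRecords}

/-- The exponential generating function of rooted labeled trees with precisely `k` records. -/
noncomputable def recordGF (k : ℕ) : PowerSeries ℚ :=
  PowerSeries.mk fun n => (treeRecordNumber n k : ℚ) / (n ! : ℚ)

/-- The exponential generating function of rooted labeled trees with at least `k` records. -/
noncomputable def recordGeGF (k : ℕ) : PowerSeries ℚ :=
  PowerSeries.mk fun n => (treeRecordGeNumber n k : ℚ) / (n ! : ℚ)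

/-- Cayley's tree function `T(z) = ∑_{n ≥ 1} n ^ (n - 1) z ^ n / n!`. -/
noncomputable def cayleyTreeFunction : PowerSeries ℚ :=
  PowerSeries.mk fun n => if n = 0 then 0 else (n : ℚ) ^ (n - 1) / (n ! : ℚ)

/-!
A rooted labeled tree is encoded by its parent function (`ParentTree`); a vertex is then a record if
none of its iterated parents is larger (`ParentTree.toRooted_bijective`,
`ParentTree.toRooted_isRecord`).

The records are counted by splitting off the largest label `m` together with its descendants. If `m`
is the root, it is the only record. Otherwise, cutting the edge above `m` leaves a tree on the set
`S` of the non-descendants of `m`, with a marked vertex to which `m` was attached, and a tree with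
root `m` on the complement of `S`; this is a bijection (`ParentTree.cutEquiv`). All descendants of
`m` other than `m` have the larger ancestor `m`, while ancestors within `S` are unaffected by the
cut, so exactly one record, `m` itself, is lost (`ParentTree.numRecords_splice`). Hence, if `W_F`
denotes the exponential generating function of the trees weighted by `F (number of records)`,
`W_F' = E * (F 1 + z * W_G')` with `G j = F (j + 1)`, where `E` is the exponential generating
function of the trees in which a largest label, not counted in the size, is the root
(`ParentTree.derivative_weightGF`). All labels being equally likely as roots, `z * E` counts all
trees (`ParentTree.X_mul_maxRootedGF`).

For `F = 1` the recursion says that `A = z * E` satisfies `z * A' * (1 - A) = A`. An identity of Abel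
shows that Cayley's tree function `T` satisfies the same equation, whose solution is unique given
its first coefficients, so `A = T` (`ParentTree.weightGF_one`). For the indicator function of
"at least `k + 2` records" the recursion becomes `R' = E * z * Q' = T * Q'`, where `Q` is the
generating function of the trees with at least `k + 1` records. As each tree has a record, namely
its root, the case of at least one record is `A = T`, and induction gives `T ^ k / k`. The formula for
exactly `k` records is the difference of two consecutive ones.
-/

/-! ### Trees as parent functions -/

/-- A rooted tree on the vertex set `α`, encoded by its parent function: the root is its own parent,
and iterating the parent function leads from each vertex to the root. -/
@[ext]
structure ParentTree (α : Type*) where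
  parent : α → α
  root : α
  parent_root : parent root = root
  exists_iterate_eq_root : ∀ v, ∃ k, parent^[k] v = root

namespace ParentTree

variable {α β : Type*}

instance instFinite [Finite α] : Finite (ParentTree α) :=
  Finite.of_injective (fun t : ParentTree α => (t.parent, t.root)) fun _ _ h =>
    ParentTree.ext (congrArg Prod.fst h) (congrArg Prod.snd h)

noncomputable instance instFintype [Finite α] : Fintype (ParentTree α) := Fintype.ofFinite _

lemma iterate_root (t : ParentTree α) (k : ℕ) : t.parent^[k] t.root = t.root :=
  Function.iterate_fixed t.parent_root k

/-- The root is the only periodic point of the parent function. -/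
lemma eq_root_of_iterate_eq (t : ParentTree α) {v : α} {k : ℕ} (h : t.parent^[k + 1] v = v) :
    v = t.root := by
  obtain ⟨j, hj⟩ := t.exists_iterate_eq_root v
  have h1 : t.parent^[(k + 1) * j] v = v := by
    rw [Function.iterate_mul]
    exact Function.iterate_fixed h j
  rw [show (k + 1) * j = k * j + j by ring, Function.iterate_add_apply, hj, iterate_root] at h1
  exact h1.symm

/-- The simple graph whose edges join the vertices other than the root to their parents. -/
def graph (t : ParentTree α) : SimpleGraph α := SimpleGraph.fromRel fun v w => t.parent v = w

lemma graph_adj (t : ParentTree α) {v w : α} :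
    t.graph.Adj v w ↔ v ≠ w ∧ (t.parent v = w ∨ t.parent w = v) := Iff.rfl

lemma parent_ne (t : ParentTree α) {v : α} (hv : v ≠ t.root) : t.parent v ≠ v :=
  fun h => hv (t.eq_root_of_iterate_eq (k := 0) h)

lemma adj_parent (t : ParentTree α) {v : α} (hv : v ≠ t.root) : t.graph.Adj v (t.parent v) :=
  ⟨(t.parent_ne hv).symm, Or.inl rfl⟩

/-- The iterated parents of a vertex are the vertices of a path to the root. -/
lemma exists_isPath (t : ParentTree α) (v : α) :
    ∃ p : t.graph.Walk v t.root, p.IsPath ∧ (∀ u, u ∈ p.support ↔ ∃ j, t.parent^[j] v = u) ∧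
      p.snd = t.parent v := by
  obtain ⟨k, hk⟩ := t.exists_iterate_eq_root v
  induction k generalizing v with
  | zero =>
    obtain rfl : v = t.root := hk
    refine ⟨.nil, .nil, fun u => ?_, ?_⟩
    · simp [iterate_root, eq_comm]
    · simp [t.parent_root]
  | succ k ih =>
    by_cases hv : v = t.root
    · subst hv
      exact ih _ (t.iterate_root k)
    obtain ⟨p, hp, hs, -⟩ := ih (t.parent v) hk
    refine ⟨.cons (t.adj_parent hv) p, ?_, fun u => ?_, ?_⟩
    · rw [SimpleGraph.Walk.cons_isPath_iff]
      refine ⟨hp, fun h => ?_⟩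
      obtain ⟨j, hj⟩ := (hs v).1 h
      exact hv (t.eq_root_of_iterate_eq (k := j) hj)
    · rw [SimpleGraph.Walk.support_cons, List.mem_cons, hs]
      constructor
      · rintro (rfl | ⟨j, hj⟩)
        · exact ⟨0, rfl⟩
        · exact ⟨j + 1, hj⟩
      · rintro ⟨_ | j, hj⟩
        · exact Or.inl hj.symm
        · exact Or.inr ⟨j, hj⟩
    · simp

lemma graph_connected (t : ParentTree α) : t.graph.Connected := by
  have h (v : α) : t.graph.Reachable v t.root := (t.exists_isPath v).choose.reachable
  exact { preconnected := fun v w => (h v).trans (h w).symm, nonempty := ⟨t.root⟩ }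

lemma graph_isTree [Finite α] (t : ParentTree α) : t.graph.IsTree := by
  rw [SimpleGraph.isTree_iff_connected_and_card]
  refine ⟨t.graph_connected, le_antisymm ?_ t.graph_connected.card_vert_le_card_edgeSet_add_one⟩
  have hsub : t.graph.edgeSet ⊆ (fun v => s(v, t.parent v)) '' {t.root}ᶜ := by
    intro e
    induction e using Sym2.ind with
    | _ v w =>
    rw [SimpleGraph.mem_edgeSet, graph_adj]
    rintro ⟨hne, rfl | rfl⟩
    · exact ⟨v, fun h => hne (by rw [Set.mem_singleton_iff.1 h, t.parent_root]), rfl⟩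
    · exact ⟨w, fun h => hne (by rw [Set.mem_singleton_iff.1 h, t.parent_root]), Sym2.eq_swap⟩
  have h1 : t.graph.edgeSet.ncard ≤ ({t.root}ᶜ : Set α).ncard :=
    (Set.ncard_le_ncard hsub (Set.toFinite _)).trans (Set.ncard_image_le (Set.toFinite _))
  have h2 := Set.ncard_add_ncard_compl ({t.root} : Set α)
  rw [Set.ncard_singleton] at h2
  rw [Nat.card_coe_set_eq]
  lia

/-- A tree with a distinguished vertex comes from a parent function: the parent of a vertex is a
neighbour closer to the root. -/
lemma exists_of_isTree {G : SimpleGraph α} (hG : G.IsTree) (r : α) :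
    ∃ t : ParentTree α, t.graph = G ∧ t.root = r := by
  have key (v : α) : ∃ w, (v = r → w = r) ∧ (v ≠ r → G.Adj v w ∧ G.dist w r < G.dist v r) := by
    by_cases hv : v = r
    · exact ⟨r, fun _ => rfl, fun h => absurd hv h⟩
    obtain ⟨p, hp⟩ := hG.connected.exists_walk_length_eq_dist v r
    cases p with
    | nil => exact absurd rfl hv
    | cons h q =>
      refine ⟨_, fun h => absurd h hv, fun _ => ⟨h, ?_⟩⟩
      have := SimpleGraph.dist_le q
      rw [SimpleGraph.Walk.length_cons] at hp
      lia
  choose f hf1 hf2 using key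
  have hit (d : ℕ) : ∀ v, G.dist v r ≤ d → ∃ k, f^[k] v = r := by
    induction d with
    | zero =>
      intro v hv
      exact ⟨0, hG.connected.dist_eq_zero_iff.1 (Nat.le_zero.1 hv)⟩
    | succ d ih =>
      intro v hv
      by_cases h : v = r
      · exact ⟨0, h⟩
      obtain ⟨k, hk⟩ := ih (f v) (by have := (hf2 v h).2; lia)
      exact ⟨k + 1, hk⟩
  let t : ParentTree α := ⟨f, r, hf1 r rfl, fun v => hit _ v le_rfl⟩
  refine ⟨t, ?_, rfl⟩
  -- a tree is minimal among the connected graphs on its vertex set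
  have hle : t.graph ≤ G := by
    intro v w h
    obtain ⟨hne, h | h⟩ := t.graph_adj.1 h
    · have hv : v ≠ r := by
        rintro rfl
        exact hne ((hf1 _ rfl).symm.trans h)
      exact (show f v = w from h) ▸ (hf2 v hv).1
    · have hw : w ≠ r := by
        rintro rfl
        exact hne (h.symm.trans (hf1 _ rfl))
      exact ((show f w = v from h) ▸ (hf2 w hw).1).symm
  exact le_antisymm hle ((SimpleGraph.isTree_iff_minimal_connected.1 hG).2 t.graph_connected hle)

/-- A vertex is a record if none of its ancestors is larger. -/
def IsRecord [LE α] (t : ParentTree α) (v : α) : Prop := ∀ k, t.parent^[k] v ≤ v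

/-- The number of records. -/
noncomputable def numRecords [LE α] (t : ParentTree α) : ℕ := Nat.card {v // t.IsRecord v}

/-- The rooted labeled tree with a given parent function. -/
def toRooted {n : ℕ} (t : ParentTree (Fin n)) : RootedLabeledTree n :=
  ⟨t.graph, t.graph_isTree, t.root⟩

lemma toRooted_isRecord {n : ℕ} (t : ParentTree (Fin n)) (v : Fin n) :
    t.toRooted.IsRecord v ↔ t.IsRecord v := by
  obtain ⟨p, hp, hs, -⟩ := t.exists_isPath v
  constructor
  · intro h k
    exact h p hp _ ((hs _).2 ⟨k, rfl⟩)
  · intro h q hq u hu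
    have hpq : q = p :=
      congrArg Subtype.val ((t.graph_isTree.isAcyclic.subsingleton_path _ _).elim ⟨q, hq⟩ ⟨p, hp⟩)
    subst hpq
    obtain ⟨j, rfl⟩ := (hs u).1 hu
    exact h j

lemma toRooted_numRecords {n : ℕ} (t : ParentTree (Fin n)) :
    t.toRooted.numRecords = t.numRecords :=
  Nat.card_congr (Equiv.subtypeEquivRight t.toRooted_isRecord)

lemma toRooted_bijective (n : ℕ) :
    Function.Bijective (toRooted : ParentTree (Fin n) → RootedLabeledTree n) := by
  constructor
  · rintro s t h
    have hg : s.graph = t.graph := congrArg RootedLabeledTree.graph h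
    have hr : s.root = t.root := congrArg RootedLabeledTree.root h
    refine ParentTree.ext (funext fun v => ?_) hr
    -- both parents are the second vertex of the unique path to the root
    obtain ⟨p, hp, -, hps⟩ := s.exists_isPath v
    obtain ⟨q, hq, -, hqs⟩ := t.exists_isPath v
    rw [← hps, ← hqs]
    have hT := t.graph_isTree
    clear hps hqs h
    revert p q hT
    generalize t.graph = G at hg ⊢
    subst hg
    rw [← hr]
    intro p hp q hq hT
    rw [show p = q from
      congrArg Subtype.val ((hT.isAcyclic.subsingleton_path _ _).elim ⟨p, hp⟩ ⟨q, hq⟩)]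
  · rintro ⟨G, hG, r⟩
    obtain ⟨t, h1, h2⟩ := exists_of_isTree hG r
    exact ⟨t, RootedLabeledTree.ext h1 h2⟩

end ParentTree

lemma card_rootedLabeledTree_numRecords (n : ℕ) (P : ℕ → Prop) :
    Nat.card {t : RootedLabeledTree n // P t.numRecords} =
      Nat.card {t : ParentTree (Fin n) // P t.numRecords} :=
  (Nat.card_congr ((Equiv.ofBijective _ (ParentTree.toRooted_bijective n)).subtypeEquiv fun t => by
    simp [ParentTree.toRooted_numRecords])).symm

/-! ### Relabeling -/

namespace ParentTree

variable {α β : Type*}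

lemma iterate_conj (e : α ≃ β) (f : α → α) (k : ℕ) (v : α) :
    (fun w => e (f (e.symm w)))^[k] (e v) = e (f^[k] v) := by
  have h : Function.Semiconj e f fun w => e (f (e.symm w)) := fun v => by simp
  exact (h.iterate_right k v).symm

/-- Relabeling of the vertices along a bijection. -/
@[simps]
def relabel (e : α ≃ β) (t : ParentTree α) : ParentTree β where
  parent w := e (t.parent (e.symm w))
  root := e t.root
  parent_root := by simp [t.parent_root]
  exists_iterate_eq_root w := by
    obtain ⟨k, hk⟩ := t.exists_iterate_eq_root (e.symm w)
    refine ⟨k, ?_⟩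
    obtain ⟨v, rfl⟩ := e.surjective w
    rw [iterate_conj, ← hk, e.symm_apply_apply]

/-- Relabeling as a bijection between sets of trees. -/
def relabelEquiv (e : α ≃ β) : ParentTree α ≃ ParentTree β where
  toFun := relabel e
  invFun := relabel e.symm
  left_inv t := by ext <;> simp
  right_inv t := by ext <;> simp

lemma numRecords_relabel [Preorder α] [Preorder β] (e : α ≃o β) (t : ParentTree α) :
    (t.relabel e.toEquiv).numRecords = t.numRecords := by
  refine (Nat.card_congr (e.toEquiv.subtypeEquiv fun v => ?_)).symm
  refine forall_congr' fun k => ?_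
  rw [show (t.relabel e.toEquiv).parent^[k] (e.toEquiv v) = e (t.parent^[k] v) from
    iterate_conj e.toEquiv t.parent k v]
  exact (e.le_iff_le).symm

lemma one_le_numRecords [Finite α] [Preorder α] (t : ParentTree α) : 1 ≤ t.numRecords := by
  have : Nonempty {v // t.IsRecord v} := ⟨⟨t.root, fun k => (t.iterate_root k).le⟩⟩
  exact Nat.card_pos

lemma card_root_eq (e : α ≃ β) (r : α) :
    Nat.card {t : ParentTree α // t.root = r} = Nat.card {t : ParentTree β // t.root = e r} :=
  Nat.card_congr ((relabelEquiv e).subtypeEquiv fun t => by simp [relabelEquiv])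

/-- By symmetry, each vertex is the root of equally many trees. -/
lemma card_mul_card_root_eq [Finite α] (r : α) :
    Nat.card α * Nat.card {t : ParentTree α // t.root = r} = Nat.card (ParentTree α) := by
  classical
  have := Fintype.ofFinite α
  rw [← Nat.card_congr (Equiv.sigmaFiberEquiv (fun t : ParentTree α => t.root)), Nat.card_sigma,
    Finset.sum_congr rfl fun s _ => ?_]
  · rw [Finset.sum_const, Finset.card_univ, Nat.card_eq_fintype_card, smul_eq_mul]
  · simpa using card_root_eq (Equiv.swap s r) s

/-- The number of trees on `n` labels with a prescribed root, as a rational number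
(with the value `0` for `n = 0`). -/
noncomputable def rootedCount (n : ℕ) : ℚ := Nat.card (ParentTree (Fin n)) / n

lemma card_root_eq_rootedCount [Finite α] (r : α) :
    (Nat.card {t : ParentTree α // t.root = r} : ℚ) = rootedCount (Nat.card α) := by
  have : Nonempty α := ⟨r⟩
  have hpos : (Nat.card α : ℚ) ≠ 0 := by exact_mod_cast Nat.card_pos.ne'
  rw [rootedCount, eq_div_iff hpos, ← Nat.card_congr (relabelEquiv (Finite.equivFin α)),
    ← card_mul_card_root_eq r]
  push_cast
  ring

/-! ### Cutting the edge above a vertex -/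

/-- The vertex `m` is not the root, and `S` is the set of the vertices that are not descendants of
`m` (where `m` counts as its own descendant). -/
def IsOutside (t : ParentTree α) (m : α) (S : Finset α) : Prop :=
  t.root ≠ m ∧ ∀ v, v ∈ S ↔ ∀ k, t.parent^[k] v ≠ m

namespace IsOutside

variable {t : ParentTree α} {S : Finset α} {m : α}

lemma notMem (ht : t.IsOutside m S) : m ∉ S := fun h => (ht.2 m).1 h 0 rfl

lemma parent_mem (ht : t.IsOutside m S) {v : α} (hv : v ∈ S) : t.parent v ∈ S :=
  (ht.2 _).2 fun k => (ht.2 v).1 hv (k + 1)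

lemma root_mem (ht : t.IsOutside m S) : t.root ∈ S := (ht.2 _).2 fun k => by
  rw [iterate_root]
  exact ht.1

lemma exists_iterate_eq (ht : t.IsOutside m S) {v : α} (hv : v ∉ S) : ∃ k, t.parent^[k] v = m := by
  simpa using mt (ht.2 v).2 hv

lemma parent_notMem (ht : t.IsOutside m S) {v : α} (hv : v ∉ S) (hvm : v ≠ m) : t.parent v ∉ S := by
  obtain ⟨_ | k, hk⟩ := ht.exists_iterate_eq hv
  · exact absurd hk hvm
  · exact fun h => (ht.2 _).1 h k hk

lemma parent_self_mem (ht : t.IsOutside m S) : t.parent m ∈ S := by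
  by_contra h
  obtain ⟨k, hk⟩ := ht.exists_iterate_eq h
  exact ht.1 (t.eq_root_of_iterate_eq (k := k) hk).symm

end IsOutside

section Splice

variable [DecidableEq α] {S : Finset α} {m : α}

/-- The parent function obtained from two trees on complementary vertex sets by making the vertex
`s` of the first one the parent of the root `m` of the second one. -/
def spliceParent (m : α) (g : ParentTree S) (s : S) (h : ParentTree {v // v ∉ S}) (v : α) : α :=
  if hv : v ∈ S then g.parent ⟨v, hv⟩ else if v = m then s else h.parent ⟨v, hv⟩

lemma spliceParent_iterate_mem (g : ParentTree S) (s : S) (h : ParentTree {v // v ∉ S}) (k : ℕ)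
    (v : S) : (spliceParent m g s h)^[k] v = (g.parent^[k] v : S) := by
  have hs : Function.Semiconj ((↑) : S → α) g.parent (spliceParent m g s h) :=
    fun v => by simp [spliceParent]
  exact (hs.iterate_right k v).symm

lemma exists_spliceParent_iterate_eq (g : ParentTree S) (s : S) (h : ParentTree {v // v ∉ S})
    (hm : (h.root : α) = m) (v : {v // v ∉ S}) :
    ∃ k, (spliceParent m g s h)^[k] v = m := by
  obtain ⟨k, hk⟩ := h.exists_iterate_eq_root v
  induction k generalizing v with
  | zero => exact ⟨0, (congrArg Subtype.val hk).trans hm⟩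
  | succ k ih =>
    by_cases hv : (v : α) = m
    · exact ⟨0, hv⟩
    obtain ⟨j, hj⟩ := ih (h.parent v) hk
    refine ⟨j + 1, ?_⟩
    rwa [Function.iterate_succ_apply,
      show spliceParent m g s h v = h.parent v by simp [spliceParent, hv, v.2]]

/-- The tree obtained by hanging the second tree below the vertex `s` of the first one. -/
def splice (hmS : m ∉ S) (g : ParentTree S) (s : S)
    (h : {h : ParentTree {v // v ∉ S} // h.root = ⟨m, hmS⟩}) : ParentTree α where
  parent := spliceParent m g s h.1
  root := g.root
  parent_root := by simp [spliceParent, g.parent_root]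
  exists_iterate_eq_root := by
    have hS (v : S) : ∃ k, (spliceParent m g s h.1)^[k] v = g.root := by
      obtain ⟨k, hk⟩ := g.exists_iterate_eq_root v
      exact ⟨k, by rw [spliceParent_iterate_mem, hk]⟩
    intro v
    by_cases hv : v ∈ S
    · exact hS ⟨v, hv⟩
    · obtain ⟨j, hj⟩ := exists_spliceParent_iterate_eq g s h.1 (congrArg Subtype.val h.2) ⟨v, hv⟩
      obtain ⟨k, hk⟩ := hS s
      refine ⟨k + (1 + j), ?_⟩
      rw [Function.iterate_add_apply, Function.iterate_add_apply, hj, ← hk]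
      simp [spliceParent, hmS]

lemma splice_isOutside (hmS : m ∉ S) (g : ParentTree S) (s : S)
    (h : {h : ParentTree {v // v ∉ S} // h.root = ⟨m, hmS⟩}) :
    (splice hmS g s h).IsOutside m S := by
  refine ⟨fun hr => hmS (hr ▸ g.root.2), fun v => ⟨fun hv k hk => ?_, fun hv => ?_⟩⟩
  · have := spliceParent_iterate_mem (m := m) g s h.1 k ⟨v, hv⟩
    exact hmS (hk.symm.trans this ▸ Subtype.mem _)
  · by_contra hvS
    obtain ⟨k, hk⟩ := exists_spliceParent_iterate_eq g s h.1 (congrArg Subtype.val h.2) ⟨v, hvS⟩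
    exact hv k hk

/-- The tree that remains when `m` and its descendants are removed. -/
@[simps]
def inner (t : ParentTree α) (ht : t.IsOutside m S) : ParentTree S where
  parent v := ⟨t.parent v, ht.parent_mem v.2⟩
  root := ⟨t.root, ht.root_mem⟩
  parent_root := Subtype.ext t.parent_root
  exists_iterate_eq_root v := by
    have hs : Function.Semiconj ((↑) : S → α) (fun v => ⟨t.parent v, ht.parent_mem v.2⟩) t.parent :=
      fun v => rfl
    obtain ⟨k, hk⟩ := t.exists_iterate_eq_root v
    exact ⟨k, Subtype.ext ((hs.iterate_right k v).trans hk)⟩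

/-- The subtree consisting of `m` and its descendants. -/
@[simps]
def outer (t : ParentTree α) (ht : t.IsOutside m S) : ParentTree {v // v ∉ S} where
  parent v := if hv : (v : α) = m then v else ⟨t.parent v, ht.parent_notMem v.2 hv⟩
  root := ⟨m, ht.notMem⟩
  parent_root := by simp
  exists_iterate_eq_root := by
    rintro ⟨v, hv⟩
    obtain ⟨k, hk⟩ := ht.exists_iterate_eq hv
    induction k generalizing v with
    | zero => exact ⟨0, Subtype.ext hk⟩
    | succ k ih =>
      by_cases hvm : v = m
      · exact ⟨0, Subtype.ext hvm⟩
      obtain ⟨j, hj⟩ := ih (t.parent v) (ht.parent_notMem hv hvm) hk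
      refine ⟨j + 1, ?_⟩
      rw [Function.iterate_succ_apply, ← hj]
      simp [hvm]

/-- Cutting the edge above `m`: a tree in which `m` is not the root and `S` is the set of vertices
that are not descendants of `m` amounts to a tree on `S` with a marked vertex together with a tree
on the complement of `S` with root `m`. -/
def cutEquiv (hmS : m ∉ S) :
    (ParentTree S × S) × {h : ParentTree {v // v ∉ S} // h.root = ⟨m, hmS⟩} ≃
      {t : ParentTree α // t.IsOutside m S} where
  toFun x := ⟨splice hmS x.1.1 x.1.2 x.2, splice_isOutside hmS _ _ _⟩
  invFun t := ((t.1.inner t.2, ⟨t.1.parent m, t.2.parent_self_mem⟩), ⟨t.1.outer t.2, rfl⟩)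
  left_inv := by
    rintro ⟨⟨g, s⟩, ⟨h, hr⟩⟩
    have h1 : h.parent ⟨m, hmS⟩ = ⟨m, hmS⟩ := hr ▸ h.parent_root
    refine Prod.ext (Prod.ext (ParentTree.ext ?_ ?_) ?_) (Subtype.ext (ParentTree.ext ?_ ?_))
    · ext v
      simp [splice, spliceParent]
    · rfl
    · simp [splice, spliceParent, hmS]
    · ext ⟨v, hv⟩
      by_cases hvm : v = m
      · subst hvm
        simp [h1]
      · simp [splice, spliceParent, hvm, hv]
    · exact hr.symm
  right_inv := by
    rintro ⟨t, ht⟩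
    refine Subtype.ext (ParentTree.ext (funext fun v => ?_) rfl)
    by_cases hv : v ∈ S
    · simp [splice, spliceParent, hv]
    · by_cases hvm : v = m
      · subst hvm
        simp [splice, spliceParent, hv]
      · simp [splice, spliceParent, hv, hvm]

end Splice

/-! ### Records of a spliced tree and the recursion -/

section Records

variable [LinearOrder α] {S : Finset α} {m : α}

/-- If `m` is the largest label, then the records of a spliced tree are `m` and the records of the
tree to which `m` is attached: each other descendant of `m` has the larger ancestor `m`. -/
lemma numRecords_splice [Finite α] (hmax : ∀ v, v ≤ m) (hmS : m ∉ S) (g : ParentTree S) (s : S)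
    (h : {h : ParentTree {v // v ∉ S} // h.root = ⟨m, hmS⟩}) :
    (splice hmS g s h).numRecords = g.numRecords + 1 := by
  have hg (v : S) : (splice hmS g s h).IsRecord v ↔ g.IsRecord v := by
    refine forall_congr' fun k => ?_
    rw [show (splice hmS g s h).parent^[k] v = (g.parent^[k] v : S) from
      spliceParent_iterate_mem g s h.1 k v]
    exact Subtype.coe_le_coe
  have hset : {v | (splice hmS g s h).IsRecord v} = insert m ((↑) '' {v : S | g.IsRecord v}) := by
    ext v
    simp only [Set.mem_ofPred_eq, Set.mem_insert_iff, Set.mem_image]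
    constructor
    · intro hv
      by_cases hvS : v ∈ S
      · exact Or.inr ⟨⟨v, hvS⟩, (hg _).1 hv, rfl⟩
      · obtain ⟨k, hk⟩ :=
          exists_spliceParent_iterate_eq g s h.1 (congrArg Subtype.val h.2) ⟨v, hvS⟩
        exact Or.inl (le_antisymm (hmax v) (hk.symm.le.trans (hv k)))
    · rintro (rfl | ⟨v, hv, rfl⟩)
      · exact fun k => hmax _
      · exact (hg v).2 hv
  have hm : m ∉ ((↑) '' {v : S | g.IsRecord v} : Set α) := by
    rintro ⟨v, -, rfl⟩
    exact hmS v.2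
  have h1 : (splice hmS g s h).numRecords = {v | (splice hmS g s h).IsRecord v}.ncard := rfl
  have h2 : g.numRecords = {v | g.IsRecord v}.ncard := rfl
  rw [h1, h2, hset, Set.ncard_insert_of_notMem hm (Set.toFinite _),
    Set.ncard_image_of_injective _ Subtype.val_injective]

lemma numRecords_eq_one (hmax : ∀ v, v ≤ m) (t : ParentTree α) (ht : t.root = m) :
    t.numRecords = 1 := by
  have h1 : t.numRecords = {v | t.IsRecord v}.ncard := rfl
  rw [h1, Set.ncard_eq_one]
  refine ⟨m, Set.eq_singleton_iff_unique_mem.2 ⟨fun k => hmax _, fun v hv => ?_⟩⟩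
  obtain ⟨k, hk⟩ := t.exists_iterate_eq_root v
  exact le_antisymm (hmax v) (ht ▸ hk ▸ hv k)

end Records

/-- The sum of `F (number of records)` over all trees on `n` labels. -/
noncomputable def recordSum (F : ℕ → ℚ) (n : ℕ) : ℚ :=
  ∑ t : ParentTree (Fin n), F t.numRecords

/-- The sum depends only on the number of labels, since only their order matters. -/
lemma recordSum_eq (F : ℕ → ℚ) {n : ℕ} {S : Finset α} [LinearOrder α] (hS : S.card = n) :
    ∑ g : ParentTree S, F g.numRecords = recordSum F n := by
  let e : S ≃o Fin n := (S.orderIsoOfFin hS).symm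
  exact Fintype.sum_equiv (relabelEquiv e.toEquiv) _ _ fun t =>
    congrArg F (numRecords_relabel e t).symm

open Classical in
/-- The contribution of the trees with a given set of non-descendants of the largest label. -/
lemma sum_isOutside {n : ℕ} (F : ℕ → ℚ) {S : Finset (Fin (n + 1))} (hmS : Fin.last n ∉ S) :
    ∑ t : ParentTree (Fin (n + 1)) with t.IsOutside (Fin.last n) S, F t.numRecords =
      S.card * rootedCount (n + 1 - S.card) * recordSum (fun j => F (j + 1)) S.card := by
  rw [Finset.sum_subtype (p := fun t => t.IsOutside (Fin.last n) S) _ (by simp),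
    ← Fintype.sum_equiv (cutEquiv hmS) (fun x => F (x.1.1.numRecords + 1)) _
      fun x => by rw [← numRecords_splice Fin.le_last hmS x.1.1 x.1.2 x.2]; rfl,
    Fintype.sum_prod_type, Fintype.sum_prod_type, ← recordSum_eq _ rfl, Finset.mul_sum]
  refine Finset.sum_congr rfl fun g _ => ?_
  have h := card_root_eq_rootedCount (⟨Fin.last n, hmS⟩ : {v // v ∉ S})
  have hc : Nat.card {v // v ∉ S} = n + 1 - S.card := by simp
  rw [hc, Nat.card_eq_fintype_card] at h
  simp [h, mul_assoc]

open Finset in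
/-- The recursion that splits off the largest label together with its descendants. -/
lemma recordSum_succ (F : ℕ → ℚ) (n : ℕ) :
    recordSum F (n + 1) = rootedCount (n + 1) * F 1 + ∑ s ∈ range (n + 1),
      n.choose s * (s * rootedCount (n + 1 - s) * recordSum (fun j => F (j + 1)) s) := by
  classical
  set m := Fin.last n
  have h0 : ∑ t : ParentTree (Fin (n + 1)) with t.root = m, F t.numRecords =
      rootedCount (n + 1) * F 1 := by
    rw [sum_congr rfl (g := fun _ => F 1) fun t ht => by
      rw [numRecords_eq_one Fin.le_last t (mem_filter.1 ht).2], sum_const, nsmul_eq_mul]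
    have h := card_root_eq_rootedCount m
    rw [Nat.card_eq_fintype_card, Fintype.card_subtype, Nat.card_fin] at h
    rw [h]
  have h1 : ∑ t : ParentTree (Fin (n + 1)) with t.root ≠ m, F t.numRecords =
      ∑ S ∈ (univ.erase m).powerset, ∑ t : ParentTree (Fin (n + 1)) with t.IsOutside m S,
        F t.numRecords := by
    rw [← sum_fiberwise_of_maps_to (t := (univ.erase m).powerset)
      (g := fun t : ParentTree (Fin (n + 1)) => univ.filter fun v => ∀ k, t.parent^[k] v ≠ m)]
    · refine sum_congr rfl fun S _ => sum_congr ?_ fun _ _ => rfl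
      ext t
      rw [mem_filter, mem_filter, mem_filter]
      simp only [mem_filter, mem_univ, true_and, IsOutside, Finset.ext_iff, iff_comm (b := _ ∈ S)]
    · intro t _
      rw [mem_powerset]
      intro v hv
      rw [mem_erase]
      exact ⟨(mem_filter.1 hv).2 0, mem_univ _⟩
  rw [recordSum, ← sum_filter_add_sum_filter_not univ (fun t => t.root = m), h0, h1,
    sum_congr rfl fun S hS => sum_isOutside F fun h => notMem_erase m _ (mem_powerset.1 hS h),
    sum_powerset_apply_card fun s =>
      (s * rootedCount (n + 1 - s) * recordSum (fun j => F (j + 1)) s : ℚ)]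
  simp

end ParentTree

/-! ### The differential equation of the tree function -/

open Finset in
/-- The `(N + 1)`-st finite difference of the `N`-th power vanishes. Its summand with index `0` is
left out here, which matters only for `N = 0`, because `0 ^ N = 0` otherwise. -/
lemma sum_alternating_choose_mul_pow (N : ℕ) :
    ∑ i ∈ range (N + 1), (-1 : ℚ) ^ (N - i) * (N + 1).choose (i + 1) * ((i : ℚ) + 1) ^ N =
      if N = 0 then 1 else 0 := by
  rcases Nat.eq_zero_or_pos N with rfl | hN
  · simp
  have h := congrFun (fwdDiff_iter_pow_eq_zero_of_lt (R := ℚ) (Nat.lt_succ_self N)) 0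
  rw [fwdDiff_iter_eq_sum_shift, sum_range_succ'] at h
  simp only [zero_add, nsmul_eq_mul, mul_one, zsmul_eq_mul, Pi.zero_apply] at h
  rw [if_neg hN.ne', ← h]
  simp [hN.ne']

open Finset in
/-- An identity of Abel, a case of his generalization of the binomial theorem: after expansion the
inner sums are finite differences of powers without their summand at `0`, and only the one of order
`1` survives. -/
lemma sum_choose_mul_pow_mul_pow (n : ℕ) :
    ∑ i ∈ range (n + 1), ((n + 1).choose (i + 1) : ℚ) * ((i : ℚ) + 1) ^ i *
      ((n - i : ℕ) : ℚ) ^ (n - i) = ((n : ℚ) + 1) ^ (n + 1) := by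
  -- expand `(n - i) ^ (n - i)` in powers of `n + 1` and `i + 1`
  have h1 : ∀ i ∈ range (n + 1), ((n + 1).choose (i + 1) : ℚ) * ((i : ℚ) + 1) ^ i *
      ((n - i : ℕ) : ℚ) ^ (n - i) = ∑ m ∈ range (n + 1 - i),
        ((n : ℚ) + 1) ^ m * (n + 1).choose m *
          ((-1 : ℚ) ^ (n - m - i) * (n - m + 1).choose (i + 1) * ((i : ℚ) + 1) ^ (n - m)) := by
    intro i hi
    have hin : i ≤ n := Nat.lt_succ_iff.1 (mem_range.1 hi)
    rw [show ((n - i : ℕ) : ℚ) = ((n : ℚ) + 1) + -((i : ℚ) + 1) by rw [Nat.cast_sub hin]; ring,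
      add_pow ((n : ℚ) + 1), mul_sum, show n + 1 - i = n - i + 1 by lia]
    refine sum_congr rfl fun m hm => ?_
    have hm' : m ≤ n - i := Nat.lt_succ_iff.1 (mem_range.1 hm)
    have hc : (n + 1).choose (i + 1) * (n - i).choose m =
        (n + 1).choose m * (n - m + 1).choose (i + 1) := by
      have e1 := Nat.choose_mul (n := n + 1) (k := m + (i + 1)) (s := i + 1) (by lia)
      have e2 := Nat.choose_mul (n := n + 1) (k := m + (i + 1)) (s := m) (by lia)
      rw [Nat.add_sub_cancel, Nat.add_sub_add_right] at e1
      rw [Nat.add_sub_cancel_left, Nat.choose_symm_add, e1, Nat.sub_add_comm (by lia)] at e2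
      exact e2
    have hc' : ((n + 1).choose (i + 1) : ℚ) * (n - i).choose m =
        (n + 1).choose m * (n - m + 1).choose (i + 1) := by exact_mod_cast hc
    rw [neg_pow, show n - m - i = n - i - m by lia,
      show ((i : ℚ) + 1) ^ (n - m) = (i + 1) ^ i * (i + 1) ^ (n - i - m) by
        rw [← pow_add]; congr 1; lia]
    linear_combination ((i : ℚ) + 1) ^ i * (n + 1) ^ m * (-1) ^ (n - i - m) *
      (i + 1) ^ (n - i - m) * hc'
  rw [sum_congr rfl h1, sum_comm' (t' := range (n + 1)) (s' := fun m => range (n - m + 1))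
    (by intro i m; simp only [mem_range]; lia)]
  simp_rw [← mul_sum, sum_alternating_choose_mul_pow]
  rw [sum_range_succ, sum_eq_zero]
  · simp; ring
  · intro m hm
    rw [if_neg (by have := mem_range.1 hm; lia), mul_zero]

open PowerSeries

lemma PowerSeries.coeff_X_mul_derivative (f : ℚ⟦X⟧) (n : ℕ) :
    coeff n (X * d⁄dX ℚ f) = n * coeff n f := by
  rcases n with _ | n
  · simp
  · rw [coeff_succ_X_mul, coeff_derivative]
    push_cast
    ring

/-- The differential equation of the tree function. -/
lemma cayleyTreeFunction_equation :
    X * d⁄dX ℚ cayleyTreeFunction * (1 - cayleyTreeFunction) = cayleyTreeFunction := by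
  -- `1 + X * T'` is the series with coefficients `n ^ n / n!`, to which Abel's identity applies
  suffices h : cayleyTreeFunction * (1 + X * d⁄dX ℚ cayleyTreeFunction) =
      X * d⁄dX ℚ cayleyTreeFunction by linear_combination -h
  have hZ : 1 + X * d⁄dX ℚ cayleyTreeFunction =
      PowerSeries.mk fun n => (n : ℚ) ^ n / (n ! : ℚ) := by
    ext n
    rcases n with _ | n
    · simp
    · rw [map_add, coeff_succ_X_mul, coeff_derivative, cayleyTreeFunction, coeff_mk, coeff_mk]
      simp [coeff_one, pow_succ]
      ring
  have hX : X * d⁄dX ℚ cayleyTreeFunction =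
      (PowerSeries.mk fun n => (n : ℚ) ^ n / (n ! : ℚ)) - 1 := by
    rw [← hZ]; ring
  rw [hZ, hX]
  ext n
  rcases n with _ | n
  · simp [cayleyTreeFunction]
  rw [coeff_mul, Finset.Nat.sum_antidiagonal_eq_sum_range_succ
    (fun i j => coeff i cayleyTreeFunction *
      coeff j (PowerSeries.mk fun n => (n : ℚ) ^ n / (n ! : ℚ))),
    Finset.sum_range_succ']
  have h := sum_choose_mul_pow_mul_pow n
  simp only [cayleyTreeFunction, coeff_mk, map_sub, coeff_one]
  rw [if_pos trivial, zero_mul, add_zero, if_neg n.succ_ne_zero, sub_zero,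
    eq_div_iff (by positivity), Nat.cast_succ, ← h, Finset.sum_mul]
  refine Finset.sum_congr rfl fun i hi => ?_
  have hin : i + 1 ≤ n + 1 := Finset.mem_range.1 hi
  rw [Nat.cast_choose ℚ hin, if_neg i.succ_ne_zero, Nat.add_sub_cancel, Nat.add_sub_add_right]
  push_cast
  field_simp

/-- The differential equation determines a power series without constant term up to its linear
coefficient. -/
lemma PowerSeries.eq_of_X_mul_derivative_mul {f g : ℚ⟦X⟧}
    (hf : X * d⁄dX ℚ f * (1 - f) = f) (hg : X * d⁄dX ℚ g * (1 - g) = g)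
    (h0f : coeff 0 f = 0) (h0g : coeff 0 g = 0) (h1 : coeff 1 f = coeff 1 g) : f = g := by
  have key (f : ℚ⟦X⟧) (hf : X * d⁄dX ℚ f * (1 - f) = f) (n : ℕ) : ((n : ℚ) - 1) * coeff n f =
      ∑ x ∈ Finset.HasAntidiagonal.antidiagonal n, x.1 * coeff x.1 f * coeff x.2 f := by
    have h := congrArg (coeff n) hf
    rw [mul_sub, mul_one, map_sub, coeff_X_mul_derivative, coeff_mul] at h
    simp only [coeff_X_mul_derivative] at h
    linear_combination h
  ext n
  induction n using Nat.strong_induction_on with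
  | _ n ih =>
  rcases eq_or_ne n 1 with rfl | hn
  · exact h1
  have hn' : (n : ℚ) - 1 ≠ 0 := sub_ne_zero.2 (by exact_mod_cast hn)
  refine mul_left_cancel₀ hn' ?_
  rw [key f hf, key g hg]
  -- in the terms with `x.1 = n` or `x.2 = n` the other factor vanishes
  refine Finset.sum_congr rfl fun x hx => ?_
  have hx' := Finset.HasAntidiagonal.mem_antidiagonal.1 hx
  rcases Nat.eq_zero_or_pos x.1 with h | h
  · simp [h]
  rcases Nat.eq_zero_or_pos x.2 with h' | h'
  · rw [h', h0f, h0g, mul_zero, mul_zero]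
  · rw [ih x.1 (by lia), ih x.2 (by lia)]

/-! ### Generating functions -/

namespace ParentTree

/-- The exponential generating function of the trees weighted by `F` of their number of records. -/
noncomputable def weightGF (F : ℕ → ℚ) : ℚ⟦X⟧ := PowerSeries.mk fun n => recordSum F n / (n ! : ℚ)

/-- The derivative of the exponential generating function of the trees rooted at their largest
label, which is the series with coefficients `rootedCount (n + 1) / n!`. -/
noncomputable def maxRootedGF : ℚ⟦X⟧ := PowerSeries.mk fun n => rootedCount (n + 1) / (n ! : ℚ)

/-- The recursion `recordSum_succ` as an identity of generating functions. -/
lemma derivative_weightGF (F : ℕ → ℚ) :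
    d⁄dX ℚ (weightGF F) =
      maxRootedGF * (C (F 1) + X * d⁄dX ℚ (weightGF fun j => F (j + 1))) := by
  ext n
  rw [mul_add, map_add, coeff_mul_C, mul_comm maxRootedGF (X * _), coeff_mul,
    Finset.Nat.sum_antidiagonal_eq_sum_range_succ (fun i j => coeff i (X * d⁄dX ℚ
      (weightGF fun j => F (j + 1))) * coeff j maxRootedGF), coeff_derivative]
  simp only [coeff_X_mul_derivative, weightGF, maxRootedGF, coeff_mk]
  rw [recordSum_succ, Nat.factorial_succ]
  have h1 : (n ! : ℚ) ≠ 0 := by positivity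
  have h2 : (n : ℚ) + 1 ≠ 0 := by positivity
  push_cast
  rw [div_mul_eq_mul_div, mul_comm ((n : ℚ) + 1) (n ! : ℚ), mul_div_mul_right _ _ h2, add_div,
    Finset.sum_div]
  congr 1
  · ring
  refine Finset.sum_congr rfl fun i hi => ?_
  have hin : i ≤ n := Nat.lt_succ_iff.1 (Finset.mem_range.1 hi)
  rw [Nat.cast_choose ℚ hin, Nat.sub_add_comm hin]
  field_simp

lemma recordSum_zero (F : ℕ → ℚ) : recordSum F 0 = 0 := by
  have : IsEmpty (ParentTree (Fin 0)) := ⟨fun t => t.root.elim0⟩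
  simp [recordSum]

lemma X_mul_maxRootedGF : X * maxRootedGF = weightGF fun _ => 1 := by
  ext n
  rcases n with _ | n
  · simp [weightGF, recordSum_zero]
  · rw [coeff_succ_X_mul, maxRootedGF, weightGF, coeff_mk, coeff_mk, Nat.factorial_succ,
      rootedCount, recordSum]
    simp [div_div]

/-- Cayley's formula: the rooted labeled trees are counted by the tree function. -/
lemma weightGF_one : (weightGF fun _ => 1) = cayleyTreeFunction := by
  have hd := derivative_weightGF fun _ => 1
  rw [map_one] at hd
  have hE := X_mul_maxRootedGF
  have h0 : coeff 0 (weightGF fun _ => 1) = 0 := by simp [weightGF, recordSum_zero]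
  refine PowerSeries.eq_of_X_mul_derivative_mul ?_ cayleyTreeFunction_equation h0
    (by simp [cayleyTreeFunction]) ?_
  · linear_combination X * hd + (1 + X * d⁄dX ℚ (weightGF fun _ => 1)) * hE
  · have : Nat.card (ParentTree (Fin 1)) = 1 := by
      rw [Nat.card_eq_one_iff_unique]
      exact ⟨⟨fun s t => ParentTree.ext (Subsingleton.elim _ _) (Subsingleton.elim _ _)⟩,
        ⟨⟨id, 0, rfl, fun v => ⟨0, Subsingleton.elim _ _⟩⟩⟩⟩
    rw [Nat.card_eq_fintype_card] at this
    simp [weightGF, cayleyTreeFunction, recordSum, this]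

lemma card_numRecords (P : ℕ → Prop) [DecidablePred P] (n : ℕ) :
    (Nat.card {t : RootedLabeledTree n // P t.numRecords} : ℚ) =
      recordSum (fun j => if P j then 1 else 0) n := by
  rw [card_rootedLabeledTree_numRecords, Nat.card_eq_fintype_card, Fintype.card_subtype, recordSum,
    Finset.sum_boole]

lemma recordGF_eq (k : ℕ) : recordGF k = weightGF fun j => if j = k then 1 else 0 := by
  ext n
  rw [recordGF, weightGF, coeff_mk, coeff_mk, treeRecordNumber, card_numRecords (· = k)]

lemma recordGeGF_eq (k : ℕ) : recordGeGF k = weightGF fun j => if k ≤ j then 1 else 0 := by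
  ext n
  rw [recordGeGF, weightGF, coeff_mk, coeff_mk, treeRecordGeNumber, card_numRecords (k ≤ ·)]

lemma recordGeGF_one : recordGeGF 1 = cayleyTreeFunction := by
  rw [recordGeGF_eq, ← weightGF_one]
  ext n
  simp [weightGF, recordSum, one_le_numRecords]

lemma derivative_recordGeGF (k : ℕ) :
    d⁄dX ℚ (recordGeGF (k + 2)) = cayleyTreeFunction * d⁄dX ℚ (recordGeGF (k + 1)) := by
  rw [recordGeGF_eq, derivative_weightGF, recordGeGF_eq, ← weightGF_one, ← X_mul_maxRootedGF]
  simp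
  ring

lemma recordGeGF_succ (k : ℕ) :
    recordGeGF (k + 1) = (1 / ((k : ℚ) + 1)) • cayleyTreeFunction ^ (k + 1) := by
  induction k with
  | zero => simp [recordGeGF_one]
  | succ k ih =>
    refine derivative.ext ?_ ?_
    · have hC (j : ℕ) : C (1 / ((j : ℚ) + 1)) * ((j : ℚ⟦X⟧) + 1) = 1 := by
        rw [← Nat.cast_succ, ← Nat.cast_succ, ← map_natCast (C (R := ℚ)), ← map_mul,
          one_div_mul_cancel (by positivity), map_one]
      have h1 := hC k
      have h2 := hC (k + 1)
      rw [derivative_recordGeGF, ih, Derivation.map_smul, Derivation.map_smul, derivative_pow,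
        derivative_pow, smul_eq_C_mul, smul_eq_C_mul, Nat.add_sub_cancel, Nat.add_sub_cancel]
      push_cast at h1 h2 ⊢
      linear_combination cayleyTreeFunction ^ (k + 1) * d⁄dX ℚ cayleyTreeFunction * (h1 - h2)
    · rw [recordGeGF_eq]
      simp only [← coeff_zero_eq_constantCoeff_apply, weightGF, coeff_mk, recordSum_zero, zero_div,
        coeff_smul]
      simp [cayleyTreeFunction]

lemma recordGF_eq_sub (k : ℕ) : recordGF k = recordGeGF k - recordGeGF (k + 1) := by
  rw [recordGF_eq, recordGeGF_eq, recordGeGF_eq]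
  ext n
  rw [map_sub, weightGF, weightGF, weightGF, coeff_mk, coeff_mk, coeff_mk, ← sub_div, recordSum,
    recordSum, recordSum, ← Finset.sum_sub_distrib]
  congr 1
  refine Finset.sum_congr rfl fun t _ => ?_
  split_ifs <;> first | lia | norm_num

end ParentTree

theorem mainTheorem6 (k : ℕ) (hk : 1 ≤ k) :
    recordGeGF k = (1 / (k : ℚ)) • cayleyTreeFunction ^ k ∧
      recordGF k = (1 / (k : ℚ)) • cayleyTreeFunction ^ k
        - (1 / ((k : ℚ) + 1)) • cayleyTreeFunction ^ (k + 1) := by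
  obtain ⟨k, rfl⟩ : ∃ j, k = j + 1 := ⟨k - 1, by lia⟩
  have h1 := ParentTree.recordGeGF_succ k
  have h2 := ParentTree.recordGeGF_succ (k + 1)
  rw [ParentTree.recordGF_eq_sub, h1, h2]
  push_cast
  exact ⟨rfl, rfl⟩
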